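/- **Central limit theorem for the rectangular additive convolution.** Let $1\le d\le m$ be integers, put $\lambda=d/m$, and let $\sigma>0$. *Convolution.* If $p,q$ are monic real polynomials of degree $d$ with only nonnegative real roots, choose real $m\times d$ matrices $A,B$ with $p(x)=\det(xI-A^TA)$, $q(x)=\det(xI-B^TB)$, and set $$[p\boxplus_{d,\lambda}q](x)=\int_{O(m)}\int_{O(d)}\det\bigl(xI-(A+QBR^T)^T(A+QBR^T)\bigr)\,dR\,dQ ,$$ where $dQ,dR$ are the Haar probability measures on the orthogonal groups; this does not depend on the choice of $A,B$. To arbitrary polynomials $p=\sum_i(-1)^ia_ix^{d-i}$, $q=\sum_j(-1)^jb_jx^{d-j}$ of degree at most $d$ it is extended bilinearly by $$p\boxplus_{d,\lambda}q=\sum_{k=0}^d(-1)^kx^{d-k}\sum_{i+j=k}\frac{(d-i)!\,(d-j)!}{d!\,(d-k)!}\,\frac{(m-i)!\,(m-j)!}{m!\,(m-k)!}\,a_ib_j .$$ *Notation.* For a polynomial $p$ let $(\mathbb{S}p)(x)=p(x^2)$. For $p$ of degree $n$ and $\alpha>0$ let $R_\alpha(p)(x)=\alpha^{n}p(x/\alpha)$,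 so that $R_\alpha$ multiplies every root by $\alpha$. Let $L_d^{(a)}(x)=\sum_{i=0}^d(-1)^i\binom{d+a}{d-i}\frac{x^i}{i!}$ be the generalized Laguerre polynomial. Write $p\approx q$ if $p=c\,q$ for some constant $c\neq0$. *Statement.* Let $p_1,p_2,\dots$ be polynomials of degree $d$ with real nonnegative roots and the same mean of the roots $\sigma^2$: $$p_i(x)=\prod_{j=1}^d(x-r_{i,j}^2),\qquad \frac1d\sum_{j=1}^d r_{i,j}^2=\sigma^2\qquad(i\ge1),$$ with real $r_{i,j}$. Then, as $N\to\infty$, the polynomials $R_{1/\sqrt N}\bigl(\mathbb{S}[p_1\boxplus_{d,\lambda}\cdots\boxplus_{d,\lambda}p_N]\bigr)$ (convolutions bracketed from the left) converge, coefficient by coefficient and pointwise on $\mathbb{R}$, to a polynomial $P$ with $$P(x)\approx L_d^{(m-d)}\!\left(\frac{m\,x^2}{\sigma^2}\right).$$ -/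

import Mathlib

open Polynomial MeasureTheory Filter

/-- The group `O(n)` of real orthogonal `n × n` matrices is compact. -/
instance orthogonalGroup_compactSpace (n : ℕ) :
    CompactSpace (Matrix.orthogonalGroup (Fin n) ℝ) := by
  suffices h : IsCompact (Matrix.orthogonalGroup (Fin n) ℝ : Set (Matrix (Fin n) (Fin n) ℝ)) from
    isCompact_iff_compactSpace.mp h
  have hK : IsCompact {M : Matrix (Fin n) (Fin n) ℝ | ∀ i j, M i j ∈ Set.Icc (-1 : ℝ) 1} := by
    have h : IsCompact (Set.univ.pi fun _ : Fin n => Set.univ.pi fun _ : Fin n =>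
        Set.Icc (-1 : ℝ) 1) :=
      isCompact_univ_pi fun _ => isCompact_univ_pi fun _ => isCompact_Icc
    refine (congrArg IsCompact ?_).mp h
    ext M
    exact ⟨fun hM i j => hM i (Set.mem_univ i) j (Set.mem_univ j), fun hM i _ j _ => hM i j⟩
  refine hK.of_isClosed_subset ?_ ?_
  · exact isClosed_unitary
  · intro M hM i j
    have := entry_norm_bound_of_unitary (𝕜 := ℝ) hM i j
    rw [Real.norm_eq_abs, abs_le] at this
    exact this

instance orthogonalGroup_measurableSpace (n : ℕ) :
    MeasurableSpace (Matrix.orthogonalGroup (Fin n) ℝ) := borel _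

instance orthogonalGroup_borelSpace (n : ℕ) :
    BorelSpace (Matrix.orthogonalGroup (Fin n) ℝ) := ⟨rfl⟩

/-- The Haar probability measure on the orthogonal group `O(n)`. -/
noncomputable def haarO (n : ℕ) : Measure (Matrix.orthogonalGroup (Fin n) ℝ) :=
  Measure.haarMeasure ⊤

/-- For real `m × d` matrices `A`, `B`, the averaged characteristic polynomial
`∬ det (x I - (A + Q B Rᵀ)ᵀ (A + Q B Rᵀ)) dQ dR`, with `Q ∈ O(m)` and `R ∈ O(d)` distributed
according to Haar measure; the integral of a polynomial of degree `d` is taken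
coefficient by coefficient. -/
noncomputable def avgCharpoly {m d : ℕ} (A B : Matrix (Fin m) (Fin d) ℝ) : ℝ[X] :=
  ∑ k ∈ Finset.range (d + 1),
    monomial k (∫ Q : Matrix.orthogonalGroup (Fin m) ℝ, ∫ R : Matrix.orthogonalGroup (Fin d) ℝ,
      ((A + (Q : Matrix (Fin m) (Fin m) ℝ) * B * (R : Matrix (Fin d) (Fin d) ℝ).transpose).transpose
        * (A + (Q : Matrix (Fin m) (Fin m) ℝ) * B
            * (R : Matrix (Fin d) (Fin d) ℝ).transpose)).charpoly.coeff k
      ∂(haarO d) ∂(haarO m))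

/-- The bilinear extension of the rectangular convolution to all polynomials of degree at most `d`.
For `p = ∑ (-1)^i a_i x^(d-i)` and `q = ∑ (-1)^j b_j x^(d-j)` it is
`∑_k (-1)^k x^(d-k) ∑_{i+j=k} (d-i)!(d-j)!/(d!(d-k)!) * (m-i)!(m-j)!/(m!(m-k)!) * a_i b_j`;
here `p.coeff (d - i) = (-1)^i a_i`, so that the signs cancel. -/
noncomputable def rectConvExt (m d : ℕ) (p q : ℝ[X]) : ℝ[X] :=
  ∑ k ∈ Finset.range (d + 1),
    monomial (d - k) (∑ ij ∈ Finset.HasAntidiagonal.antidiagonal k,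
      (((d - ij.1).factorial * (d - ij.2).factorial : ℝ) / (d.factorial * (d - k).factorial))
      * (((m - ij.1).factorial * (m - ij.2).factorial : ℝ) / (m.factorial * (m - k).factorial))
      * p.coeff (d - ij.1) * q.coeff (d - ij.2))

open Classical in
/-- The rectangular additive convolution `p ⊞ q` with parameters `d` and `λ = d / m` (`d ≤ m`).
If `p` and `q` are the characteristic polynomials of `AᵀA` and `BᵀB` for real `m × d` matrices
`A`, `B` (that is, if they are monic of degree `d` with only nonnegative real roots), it is the
average over the orthogonal groups of the characteristic polynomial of
`(A + Q B Rᵀ)ᵀ (A + Q B Rᵀ)`. Other polynomials are convolved by the bilinear extension. -/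
noncomputable def rectConv (m d : ℕ) (p q : ℝ[X]) : ℝ[X] :=
  if h : ∃ AB : Matrix (Fin m) (Fin d) ℝ × Matrix (Fin m) (Fin d) ℝ,
      (AB.1.transpose * AB.1).charpoly = p ∧ (AB.2.transpose * AB.2).charpoly = q then
    avgCharpoly h.choose.1 h.choose.2
  else rectConvExt m d p q

/-- The `N`-fold convolution `(⋯(p 0 ⊞ p 1) ⊞ ⋯) ⊞ p (N - 1)`; the empty convolution is the
neutral element `x^d`. -/
noncomputable def rectConvN (m d : ℕ) (p : ℕ → ℝ[X]) : ℕ → ℝ[X]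
  | 0 => X ^ d
  | 1 => p 0
  | (N + 2) => rectConv m d (rectConvN m d p (N + 1)) (p (N + 1))

/-- Symmetrization: `(S p)(x) = p(x²)`. -/
noncomputable def symmetrization (p : ℝ[X]) : ℝ[X] := p.comp (X ^ 2)

/-- The normalizing operator: for `p` of degree `n` and `α > 0`, this is `α^n p(x / α)`, which
multiplies every root by `α` and keeps the leading coefficient. -/
noncomputable def rootNormalize (α : ℝ) (p : ℝ[X]) : ℝ[X] := p.scaleRoots α

/-- The generalized Laguerre polynomial
`L_n^{(a)}(x) = ∑_{i ≤ n} (-1)^i binom(n + a, n - i) x^i / i!` with integer parameter `a ≥ 0`. -/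
noncomputable def genLaguerre (n a : ℕ) : ℝ[X] :=
  ∑ i ∈ Finset.range (n + 1),
    monomial i ((-1 : ℝ) ^ i * ((n + a).choose (n - i) : ℝ) / (i.factorial : ℝ))

/-- `p ≈ q`: equality up to a nonzero constant factor. -/
def ScalarEquiv (p q : ℝ[X]) : Prop := ∃ c : ℝ, c ≠ 0 ∧ p = C c * q

/-! Up to sign and a factor `k!²`, the coefficient of `x^(d-k)` in `det(xI - MᵀM)` is the sum of the
squared `k × k` minors of `M` (Cauchy–Binet). To average it over `M = A + Q B Rᵀ`, translate `Q` and
`R` by signed permutation matrices, which preserves Haar measure. Averaging over this finite group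
is already enough: random signs remove the cross terms in the Laplace expansion, and random
permutations decouple the minors of `A` from those of `Q B Rᵀ`. What remains involves `Q B Rᵀ` only
through its sums of squared minors, which are orthogonally invariant. The integral therefore equals
the explicit bilinear formula (`avgCharpoly_eq_rectConvExt`).

After the rescaling `rectCoeff` of coefficients, that formula is multiplication of power series
truncated at `z^d`. Each `p i` becomes `1 + a z + O(z²)` with the same `a = -σ²/m`, because the mean
of the roots is fixed, and with uniformly bounded coefficients, because nonnegative roots of sum
`dσ²` lie in `[0, dσ²]`. The `k`-th coefficient of a product of `N` such series is asymptotic to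
that of `(1 + a z)^N`, with limit `a^k / k!` after division by `N^k`
(`isLittleO_sub_choose_of_recurrence`). The dilation by `1/√N` performs this division, and undoing
the rescaling turns `a^k / k!` into the Laguerre coefficients. -/

/-! ### Cauchy–Binet and sums of squared minors. -/

/-- Reindexing rows and columns by two different bijections preserves the square of the
determinant. -/
theorem Matrix.det_submatrix_equiv_sq {ι κ : Type*} [Fintype ι] [DecidableEq ι] [Fintype κ]
    [DecidableEq κ] (e f : κ ≃ ι) (M : Matrix ι ι ℝ) :
    (M.submatrix e f).det ^ 2 = M.det ^ 2 := by
  have h : M.submatrix e f = (M.submatrix id (e.symm.trans f)).submatrix e e := by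
    ext i j; simp
  rw [h, Matrix.det_submatrix_equiv_self]
  have h2 := Matrix.det_permute' (e.symm.trans f) M
  rw [h2, mul_pow]
  rcases Int.units_eq_one_or (Equiv.Perm.sign (e.symm.trans f)) with h | h <;> simp [h]

/-- The sum of the squares of the `ι × ι` minors of `M`, over ordered choices of rows and
columns. -/
noncomputable def sqMinorSum (ι : Type*) [Fintype ι] [DecidableEq ι] {α β : Type*} [Fintype α]
    [DecidableEq α] [Fintype β] [DecidableEq β] (M : Matrix α β ℝ) : ℝ :=
  ∑ s : ι ↪ α, ∑ t : ι ↪ β, (M.submatrix s t).det ^ 2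

/-- Each row of `A * B` is a combination of rows of `B`. Multilinear expansion gives a sum over all
maps `ι → α`, and a non-injective map repeats a row of `B`. -/
theorem Matrix.det_mul_eq_sum_prod_mul_det {ι α : Type*} [Fintype ι] [DecidableEq ι] [Fintype α]
    [DecidableEq α] (A : Matrix ι α ℝ) (B : Matrix α ι ℝ) :
    (A * B).det = ∑ s : ι ↪ α, (∏ i, A i (s i)) * (B.submatrix s id).det := by
  classical
  have h1 : (A * B).det = ∑ p : ι → α, (∏ i, A i (p i)) * (B.submatrix p id).det := by
    have h : (A * B) = fun i => ∑ r : α, A i r • B r := by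
      ext i j; simp [Matrix.mul_apply]
    have h2 := (Matrix.detRowAlternating (n := ι) (R := ℝ)).toMultilinearMap.map_sum
      (fun i (r : α) => A i r • B r)
    have h3 : (A * B).det = (Matrix.detRowAlternating (n := ι) (R := ℝ)).toMultilinearMap
      (fun i => ∑ r : α, A i r • B r) := by rw [h]; rfl
    rw [h3, h2]
    refine Finset.sum_congr rfl fun p _ => ?_
    rw [MultilinearMap.map_smul_univ]
    rfl
  rw [h1]
  refine Eq.trans ?_ (Finset.sum_map Finset.univ ⟨fun s : ι ↪ α => (s : ι → α), DFunLike.coe_injective⟩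
    (fun p : ι → α => (∏ i, A i (p i)) * (B.submatrix p id).det))
  refine (Finset.sum_subset (Finset.subset_univ _) fun p _ hp => ?_).symm
  have hp' : ¬ Function.Injective p := fun h => hp (by simpa using ⟨⟨p, h⟩, rfl⟩)
  obtain ⟨i, j, hij, hne⟩ : ∃ i j, p i = p j ∧ i ≠ j := by
    simpa [Function.Injective] using hp'
  rw [Matrix.det_zero_of_row_eq hne (by ext; simp [hij]), mul_zero]

/-- A form of the Cauchy–Binet formula, with the minors indexed by ordered choices of rows. -/
theorem Matrix.factorial_mul_det_transpose_mul_self {ι α : Type*} [Fintype ι] [DecidableEq ι]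
    [Fintype α] [DecidableEq α] (N : Matrix α ι ℝ) :
    ((Fintype.card ι).factorial : ℝ) * (N.transpose * N).det
      = ∑ s : ι ↪ α, (N.submatrix s id).det ^ 2 := by
  -- One formula for the same determinant per permutation `σ`, obtained by reordering `s`. Summed
  -- over `σ`, the signed products rebuild a second copy of the minor.
  have key : ∀ σ : Equiv.Perm ι, (N.transpose * N).det = ∑ s : ι ↪ α,
      ((Equiv.Perm.sign σ : ℤ) : ℝ) * (∏ i, N (s (σ i)) i) * (N.submatrix s id).det := by
    intro σ
    rw [Matrix.det_mul_eq_sum_prod_mul_det]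
    rw [← Equiv.sum_comp (Equiv.embeddingCongr σ.symm (Equiv.refl α))]
    refine Finset.sum_congr rfl fun s _ => ?_
    have : N.submatrix (Equiv.embeddingCongr σ.symm (Equiv.refl α) s) id
        = (N.submatrix s id).submatrix σ id := by
      ext i j; simp [Equiv.embeddingCongr]
    rw [this, Matrix.det_permute]
    simp [Equiv.embeddingCongr]
    ring
  have h := Finset.sum_congr rfl (fun σ (_ : σ ∈ (Finset.univ : Finset (Equiv.Perm ι))) => key σ)
  rw [Finset.sum_const, Finset.card_univ, Fintype.card_perm, nsmul_eq_mul] at h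
  rw [h, Finset.sum_comm]
  refine Finset.sum_congr rfl fun s _ => ?_
  rw [← Finset.sum_mul, sq]
  congr 1
  rw [Matrix.det_apply']
  rfl

/-- Coefficients of the characteristic polynomial as sums of principal minors indexed by ordered
choices of rows. -/
theorem Matrix.factorial_mul_charpoly_coeff {α : Type*} [Fintype α] [DecidableEq α]
    (G : Matrix α α ℝ) (k : ℕ) (hk : k ≤ Fintype.card α) :
    (k.factorial : ℝ) * G.charpoly.coeff (Fintype.card α - k)
      = (-1) ^ k * ∑ t : Fin k ↪ α, (G.submatrix t t).det := by
  rw [Matrix.charpoly_coeff_eq_sum_minors G k hk, mul_left_comm]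
  congr 1
  rw [Finset.mul_sum]
  -- Group the embeddings by image: the `k!` orderings of a set `S` all give the same principal
  -- minor.
  rw [← Finset.sum_fiberwise_of_maps_to (s := Finset.univ)
    (t := Finset.univ.powersetCard k) (g := fun t : Fin k ↪ α => Finset.univ.map t)]
  · refine Finset.sum_congr rfl fun S hS => ?_
    have hcard : S.card = k := (Finset.mem_powersetCard.mp hS).2
    have hdet : ∀ t ∈ Finset.univ.filter (fun t : Fin k ↪ α => Finset.univ.map t = S),
        (G.submatrix t t).det
          = (G.submatrix (Subtype.val : S → α) (Subtype.val : S → α)).det := by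
      intro t ht
      have ht' : Finset.univ.map t = S := by simpa using ht
      have hmem : ∀ i, t i ∈ S := fun i => by rw [← ht']; simp
      let e : Fin k ≃ S := Equiv.ofBijective (fun i => ⟨t i, hmem i⟩) <| by
        rw [Fintype.bijective_iff_injective_and_card]
        exact ⟨fun i j h => t.injective (by simpa using h), by simp [hcard]⟩
      rw [← Matrix.det_submatrix_equiv_self e]
      rfl
    rw [Finset.sum_congr rfl hdet, Finset.sum_const, nsmul_eq_mul]
    congr 2
    have hS' : Fintype.card (Fin k ≃ S) = k.factorial := by
      rw [Fintype.card_equiv (Fintype.equivOfCardEq (by simp [hcard]))]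
      simp
    rw [← hS', ← Finset.card_univ]
    refine Finset.card_bij (fun e _ => e.toEmbedding.trans (Function.Embedding.subtype _)) ?_ ?_ ?_
    · intro e _
      simp only [Finset.mem_filter, Finset.mem_univ, true_and]
      ext x
      simp only [Finset.mem_map, Finset.mem_univ, true_and]
      exact ⟨by rintro ⟨i, rfl⟩; exact (e i).2, fun hx => ⟨e.symm ⟨x, hx⟩, by simp⟩⟩
    · intro e _ e' _ h
      ext i
      exact DFunLike.congr_fun h i
    · intro t ht
      have ht' : Finset.univ.map t = S := by simpa using ht
      have hmem : ∀ i, t i ∈ S := fun i => by rw [← ht']; simp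
      refine ⟨Equiv.ofBijective (fun i => ⟨t i, hmem i⟩) ?_, Finset.mem_univ _, by ext i; rfl⟩
      rw [Fintype.bijective_iff_injective_and_card]
      exact ⟨fun i j h => t.injective (by simpa using h), by simp [hcard]⟩
  · intro t _
    simp [Finset.mem_powersetCard]

/-- The principal minors of `MᵀM` are expanded by Cauchy–Binet. One `k!` accounts for the ordering
of the columns, the other for that of the rows. -/
theorem charpoly_transpose_mul_self_coeff {α β : Type*} [Fintype α] [DecidableEq α] [Fintype β]
    [DecidableEq β] (M : Matrix α β ℝ) (k : ℕ) (hk : k ≤ Fintype.card β) :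
    (M.transpose * M).charpoly.coeff (Fintype.card β - k)
      = (-1) ^ k / (k.factorial : ℝ) ^ 2 * sqMinorSum (Fin k) M := by
  have hf : (k.factorial : ℝ) ≠ 0 := by positivity
  have h := Matrix.factorial_mul_charpoly_coeff (M.transpose * M) k hk
  have h2 : ∀ t : Fin k ↪ β, ((M.transpose * M).submatrix t t).det
      = (k.factorial : ℝ)⁻¹ * ∑ s : Fin k ↪ α, (M.submatrix s t).det ^ 2 := by
    intro t
    have h3 := Matrix.factorial_mul_det_transpose_mul_self (M.submatrix id t)
    rw [Fintype.card_fin] at h3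
    rw [eq_inv_mul_iff_mul_eq₀ hf]
    exact h3
  simp_rw [h2] at h
  rw [← Finset.mul_sum, Finset.sum_comm] at h
  unfold sqMinorSum
  field_simp
  field_simp at h
  linear_combination h

/-! ### Averaging over random signs. -/

section SignAverage

variable {ι α β : Type*} [Fintype ι] [DecidableEq ι] [Fintype α] [DecidableEq α]

/-- Orthogonality of the characters of the sign group; distinct `i` carry independent signs since
`s` is injective. -/
theorem sum_sign_prod_mul_prod (s : ι ↪ α) (U V : Finset ι) :
    ∑ ε : α → ℤˣ, (∏ i ∈ U, ((ε (s i) : ℤ) : ℝ)) * ∏ i ∈ V, ((ε (s i) : ℤ) : ℝ)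
      = if U = V then (2 : ℝ) ^ Fintype.card α else 0 := by
  split_ifs with h
  · subst h
    have : ∀ ε : α → ℤˣ,
        (∏ i ∈ U, ((ε (s i) : ℤ) : ℝ)) * ∏ i ∈ U, ((ε (s i) : ℤ) : ℝ) = 1 := by
      intro ε
      rw [← Finset.prod_mul_distrib]
      refine Finset.prod_eq_one fun i _ => ?_
      rcases Int.units_eq_one_or (ε (s i)) with h | h <;> simp [h]
    simp [this]
  · obtain ⟨i₀, hi₀⟩ : ∃ i, ¬ (i ∈ U ↔ i ∈ V) := by
      by_contra! hc
      exact h (Finset.ext hc)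
    -- Flipping the sign at `s i₀`, with `i₀` in exactly one of `U` and `V`, permutes the summation
    -- range and negates the summand.
    have hflip : ∀ W : Finset ι, ∀ ε : α → ℤˣ,
        ∏ i ∈ W, ((((Pi.mulSingle (s i₀) (-1) : α → ℤˣ) * ε) (s i) : ℤˣ) : ℤ)
          = (if i₀ ∈ W then -1 else 1) * ∏ i ∈ W, (ε (s i) : ℤ) := by
      intro W ε
      simp only [Pi.mul_apply, Units.val_mul, Finset.prod_mul_distrib]
      congr 1
      have : ∀ i, (((Pi.mulSingle (s i₀) (-1) : α → ℤˣ) (s i) : ℤˣ) : ℤ)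
          = if i = i₀ then -1 else 1 := by
        intro i
        by_cases hi : i = i₀
        · simp [hi]
        · simp [hi]
      simp_rw [this]
      rw [Finset.prod_ite_eq']
    have hs := Equiv.sum_comp (Equiv.mulLeft (Pi.mulSingle (s i₀) (-1) : α → ℤˣ))
      (fun ε : α → ℤˣ => (∏ i ∈ U, ((ε (s i) : ℤ) : ℝ)) * ∏ i ∈ V, ((ε (s i) : ℤ) : ℝ))
    have hneg : ∀ ε : α → ℤˣ,
        (∏ i ∈ U, (((((Pi.mulSingle (s i₀) (-1) : α → ℤˣ) * ε) (s i) : ℤˣ) : ℤ) : ℝ))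
          * ∏ i ∈ V, (((((Pi.mulSingle (s i₀) (-1) : α → ℤˣ) * ε) (s i) : ℤˣ) : ℤ) : ℝ)
        = - ((∏ i ∈ U, ((ε (s i) : ℤ) : ℝ)) * ∏ i ∈ V, ((ε (s i) : ℤ) : ℝ)) := by
      intro ε
      simp only [← Int.cast_prod, hflip]
      by_cases h1 : i₀ ∈ U <;> by_cases h2 : i₀ ∈ V <;> simp_all
    simp only [Equiv.coe_mulLeft, hneg, Finset.sum_neg_distrib] at hs
    linarith

/-- Averaging a squared determinant over independent random signs of the rows of `Y`. -/
theorem sum_sign_det_sq (s : ι ↪ α) (X Y : Matrix ι ι ℝ) :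
    ∑ ε : α → ℤˣ, (Matrix.of fun i j => X i j + ((ε (s i) : ℤ) : ℝ) * Y i j).det ^ 2
      = (2 : ℝ) ^ Fintype.card α * ∑ U : Finset ι,
        (Matrix.of fun i j => if i ∈ U then X i j else Y i j).det ^ 2 := by
  have hexp : ∀ ε : α → ℤˣ, (Matrix.of fun i j => X i j + ((ε (s i) : ℤ) : ℝ) * Y i j).det
      = ∑ U : Finset ι, (∏ i ∈ Uᶜ, ((ε (s i) : ℤ) : ℝ))
        * (Matrix.of fun i j => if i ∈ U then X i j else Y i j).det := by
    intro ε
    have h := (Matrix.detRowAlternating (n := ι) (R := ℝ)).toMultilinearMap.map_add_univ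
      (fun i => X i) (fun i => ((ε (s i) : ℤ) : ℝ) • Y i)
    refine Eq.trans ?_ (h.trans ?_)
    · rfl
    · refine Finset.sum_congr rfl fun U _ => ?_
      have h2 := (Matrix.detRowAlternating (n := ι) (R := ℝ)).toMultilinearMap.map_smul_univ
        (fun i => if i ∈ U then 1 else ((ε (s i) : ℤ) : ℝ)) (fun i => if i ∈ U then X i else Y i)
      have h3 : (U.piecewise (fun i => X i) fun i => ((ε (s i) : ℤ) : ℝ) • Y i)
          = fun i => (if i ∈ U then 1 else ((ε (s i) : ℤ) : ℝ)) • (if i ∈ U then X i else Y i) := by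
        ext i j
        by_cases hi : i ∈ U <;> simp [hi, Finset.piecewise]
      rw [h3, h2, smul_eq_mul]
      congr 1
      · rw [Finset.prod_ite]
        simp only [Finset.prod_const_one, one_mul]
        refine Finset.prod_congr ?_ fun _ _ => rfl
        ext; simp
      · change Matrix.det _ = _
        congr 1
        ext i j
        by_cases hi : i ∈ U <;> simp [hi]
  simp_rw [hexp, sq, Finset.sum_mul_sum]
  rw [Finset.sum_comm, Finset.mul_sum]
  refine Finset.sum_congr rfl fun U _ => ?_
  rw [Finset.sum_comm]
  set D := fun U : Finset ι => (Matrix.of fun i j => if i ∈ U then X i j else Y i j).det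
  have : ∀ V : Finset ι, ∑ ε : α → ℤˣ, (∏ i ∈ Uᶜ, ((ε (s i) : ℤ) : ℝ)) * D U
      * ((∏ i ∈ Vᶜ, ((ε (s i) : ℤ) : ℝ)) * D V)
      = if U = V then (2 : ℝ) ^ Fintype.card α * (D U * D V) else 0 := by
    intro V
    have h := sum_sign_prod_mul_prod s Uᶜ Vᶜ
    simp only [compl_inj_iff] at h
    calc _ = (∑ ε : α → ℤˣ, (∏ i ∈ Uᶜ, ((ε (s i) : ℤ) : ℝ))
          * ∏ i ∈ Vᶜ, ((ε (s i) : ℤ) : ℝ)) * (D U * D V) := by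
          rw [Finset.sum_mul]
          exact Finset.sum_congr rfl fun _ _ => by ring
      _ = _ := by rw [h]; split_ifs <;> simp
  rw [Finset.sum_congr rfl fun V _ => this V]
  simp [D]

/-- The matrix with the `U × W` block of `X`, the `Uᶜ × Wᶜ` block of `Y`, and zeros elsewhere. -/
def mixedBlock (U W : Finset ι) (X Y : Matrix ι ι ℝ) : Matrix ι ι ℝ :=
  Matrix.of fun i j => if i ∈ U then (if j ∈ W then X i j else 0) else
    (if j ∈ W then 0 else Y i j)

/-- Averaging over the row signs leaves matrices whose rows each come wholly from `X` or wholly from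
`Y`; the same lemma applied to their transposes averages over the column signs. -/
theorem sum_sign_sum_sign_det_sq [Fintype β] [DecidableEq β] (s : ι ↪ α) (t : ι ↪ β)
    (X Y : Matrix ι ι ℝ) :
    ∑ ε : α → ℤˣ, ∑ δ : β → ℤˣ,
      (Matrix.of fun i j => X i j + ((ε (s i) : ℤ) : ℝ) * (Y i j * ((δ (t j) : ℤ) : ℝ))).det ^ 2
      = (2 : ℝ) ^ Fintype.card α * 2 ^ Fintype.card β * ∑ U : Finset ι, ∑ W : Finset ι,
        (mixedBlock U W X Y).det ^ 2 := by
  rw [Finset.sum_comm]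
  have h1 := fun δ : β → ℤˣ => sum_sign_det_sq s X
    (Matrix.of fun i j => Y i j * ((δ (t j) : ℤ) : ℝ))
  simp only [Matrix.of_apply] at h1
  rw [Finset.sum_congr rfl fun δ _ => h1 δ, ← Finset.mul_sum, Finset.sum_comm, mul_assoc,
    Finset.mul_sum _ _ ((2 : ℝ) ^ Fintype.card β)]
  congr 1
  refine Finset.sum_congr rfl fun U _ => ?_
  have h2 := sum_sign_det_sq t (Matrix.of fun j i => if i ∈ U then X i j else 0)
    (Matrix.of fun j i => if i ∈ U then 0 else Y i j)
  refine Eq.trans ?_ (h2.trans ?_)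
  · refine Finset.sum_congr rfl fun δ _ => ?_
    rw [← Matrix.det_transpose]
    congr 2
    ext j i
    by_cases hi : i ∈ U <;> simp [hi, mul_comm]
  · congr 1
    refine Finset.sum_congr rfl fun W _ => ?_
    rw [← Matrix.det_transpose]
    congr 2
    ext i j
    by_cases hi : i ∈ U <;> by_cases hj : j ∈ W <;> simp [hi, hj, mixedBlock]

end SignAverage

/-! ### Averaging over permutations. -/

section PermAverage

variable {ι γ κ α : Type*} [Fintype ι] [Fintype γ] [Fintype κ] [Fintype α] [DecidableEq α]

/-- Averaging over all permutations an injective choice of indices makes it uniform. -/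
theorem descFactorial_mul_sum_perm (f : κ ↪ α) (g : (κ ↪ α) → ℝ) :
    ((Fintype.card α).descFactorial (Fintype.card κ) : ℝ)
        * ∑ π : Equiv.Perm α, g (f.trans π.toEmbedding)
      = ((Fintype.card α).factorial : ℝ) * ∑ v : κ ↪ α, g v := by
  have h1 : ∀ v : κ ↪ α, ∑ π : Equiv.Perm α, g (v.trans π.toEmbedding)
      = ∑ π : Equiv.Perm α, g (f.trans π.toEmbedding) := by
    intro v
    -- Since `ρ` carries `f` to `v`, right multiplication by `ρ` shows that the sum over `π` does
    -- not depend on the starting embedding.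
    obtain ⟨ρ, hρ⟩ := Equiv.Perm.exists_extending_pair f v f.injective v.injective
    rw [← Equiv.sum_comp (Equiv.mulRight ρ)
      (fun π : Equiv.Perm α => g (f.trans π.toEmbedding))]
    refine Finset.sum_congr rfl fun π _ => ?_
    congr 1
    ext x
    simp [hρ]
  have h2 : ∑ v : κ ↪ α, ∑ π : Equiv.Perm α, g (v.trans π.toEmbedding)
      = ((Fintype.card α).descFactorial (Fintype.card κ) : ℝ)
        * ∑ π : Equiv.Perm α, g (f.trans π.toEmbedding) := by
    rw [Finset.sum_congr rfl fun v _ => h1 v, Finset.sum_const, Finset.card_univ,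
      Fintype.card_embedding_eq, nsmul_eq_mul]
  rw [← h2, Finset.sum_comm]
  have h3 : ∀ π : Equiv.Perm α, ∑ v : κ ↪ α, g (v.trans π.toEmbedding) = ∑ v : κ ↪ α, g v := by
    intro π
    rw [← Equiv.sum_comp (Equiv.embeddingCongr (Equiv.refl κ) π) g]
    rfl
  rw [Finset.sum_congr rfl fun π _ => h3 π, Finset.sum_const, Finset.card_univ,
    Fintype.card_perm, nsmul_eq_mul]

/-- The restriction of a uniformly random injection to a subset is uniformly random. -/
theorem descFactorial_mul_sum_embedding_trans (h : γ ↪ ι) (g : (γ ↪ α) → ℝ) :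
    ((Fintype.card α).descFactorial (Fintype.card γ) : ℝ) * ∑ s : ι ↪ α, g (h.trans s)
      = ((Fintype.card α).descFactorial (Fintype.card ι) : ℝ) * ∑ u : γ ↪ α, g u := by
  have hf : ((Fintype.card α).factorial : ℝ) ≠ 0 := by positivity
  have h1 : ((Fintype.card α).factorial : ℝ) * ∑ s : ι ↪ α, g (h.trans s)
      = ∑ s : ι ↪ α, ∑ π : Equiv.Perm α, g ((h.trans s).trans π.toEmbedding) := by
    rw [Finset.sum_comm]
    have h3 : ∀ π : Equiv.Perm α, ∑ s : ι ↪ α, g ((h.trans s).trans π.toEmbedding)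
        = ∑ s : ι ↪ α, g (h.trans s) := by
      intro π
      rw [← Equiv.sum_comp (Equiv.embeddingCongr (Equiv.refl ι) π) (fun s => g (h.trans s))]
      rfl
    rw [Finset.sum_congr rfl fun π _ => h3 π, Finset.sum_const, Finset.card_univ,
      Fintype.card_perm, nsmul_eq_mul]
  apply mul_left_cancel₀ hf
  rw [mul_left_comm, h1, Finset.mul_sum,
    Finset.sum_congr rfl fun s _ => descFactorial_mul_sum_perm (h.trans s) g,
    Finset.sum_const, Finset.card_univ, Fintype.card_embedding_eq, nsmul_eq_mul]
  ring

/-- For fixed `s` the permutation makes the second restriction uniform whatever `s` is, so the two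
restrictions become independent and the double sum decouples. -/
theorem sum_perm_sum_embedding (h : γ ↪ ι) (h' : κ ↪ ι) (hι : Fintype.card ι ≤ Fintype.card α)
    (K : (γ ↪ α) → (κ ↪ α) → ℝ) :
    ∑ π : Equiv.Perm α, ∑ s : ι ↪ α, K (h.trans s) ((h'.trans s).trans π.toEmbedding)
      = ((Fintype.card α).factorial * (Fintype.card α).descFactorial (Fintype.card ι) : ℝ)
          / ((Fintype.card α).descFactorial (Fintype.card γ)
            * (Fintype.card α).descFactorial (Fintype.card κ))
        * ∑ u : γ ↪ α, ∑ v : κ ↪ α, K u v := by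
  have hne : ∀ n ≤ Fintype.card ι, ((Fintype.card α).descFactorial n : ℝ) ≠ 0 := fun n hn =>
    Nat.cast_ne_zero.mpr (Nat.descFactorial_eq_zero_iff_lt.not.mpr (not_lt.mpr (hn.trans hι)))
  have hγ := hne _ (Fintype.card_le_of_embedding h)
  have hκ := hne _ (Fintype.card_le_of_embedding h')
  rw [Finset.sum_comm]
  have h1 : ∀ s : ι ↪ α, ∑ π : Equiv.Perm α, K (h.trans s) ((h'.trans s).trans π.toEmbedding)
      = ((Fintype.card α).factorial : ℝ) / (Fintype.card α).descFactorial (Fintype.card κ)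
        * ∑ v : κ ↪ α, K (h.trans s) v := by
    intro s
    have := descFactorial_mul_sum_perm (h'.trans s) (K (h.trans s))
    field_simp
    linear_combination this
  rw [Finset.sum_congr rfl fun s _ => h1 s, ← Finset.mul_sum]
  have h2 := descFactorial_mul_sum_embedding_trans (α := α) h (fun u => ∑ v : κ ↪ α, K u v)
  field_simp
  linear_combination h2

end PermAverage

/-! ### Minors averaged over signed permutations. -/

section MinorAverage

variable {ι γ κ α β : Type*} [Fintype ι] [DecidableEq ι] [Fintype γ] [DecidableEq γ] [Fintype κ]
  [DecidableEq κ] [Fintype α] [DecidableEq α] [Fintype β] [DecidableEq β]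

/-- A nonzero term of the Leibniz expansion needs a permutation carrying `W` onto `U`. -/
theorem det_mixedBlock_of_card_ne {U W : Finset ι} (h : U.card ≠ W.card) (X Y : Matrix ι ι ℝ) :
    (mixedBlock U W X Y).det = 0 := by
  rw [Matrix.det_apply']
  refine Finset.sum_eq_zero fun σ _ => ?_
  obtain ⟨i, hi⟩ : ∃ i, ¬ (σ i ∈ U ↔ i ∈ W) := by
    by_contra! hc
    refine h ?_
    rw [← Finset.card_map σ.toEmbedding (s := W)]
    congr 1
    ext x
    simp only [Finset.mem_map_equiv]
    have := hc (σ.symm x)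
    simpa using this
  rw [Finset.prod_eq_zero (Finset.mem_univ i), mul_zero]
  by_cases h1 : σ i ∈ U <;> by_cases h2 : i ∈ W <;> simp_all [mixedBlock]

/-- Reordering rows by `e` and columns by `f` makes the matrix block diagonal; squaring absorbs the
signs of the reorderings. -/
theorem det_mixedBlock_sq {U W : Finset ι} (e f : γ ⊕ κ ≃ ι)
    (heU : ∀ x, e (Sum.inl x) ∈ U) (heU' : ∀ y, e (Sum.inr y) ∉ U)
    (hfW : ∀ x, f (Sum.inl x) ∈ W) (hfW' : ∀ y, f (Sum.inr y) ∉ W) (X Y : Matrix ι ι ℝ) :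
    (mixedBlock U W X Y).det ^ 2
      = (X.submatrix (e ∘ Sum.inl) (f ∘ Sum.inl)).det ^ 2
        * (Y.submatrix (e ∘ Sum.inr) (f ∘ Sum.inr)).det ^ 2 := by
  rw [← Matrix.det_submatrix_equiv_sq e f]
  have : (mixedBlock U W X Y).submatrix e f
      = Matrix.fromBlocks (X.submatrix (e ∘ Sum.inl) (f ∘ Sum.inl)) 0 0
        (Y.submatrix (e ∘ Sum.inr) (f ∘ Sum.inr)) := by
    ext (i | i) (j | j) <;> simp [mixedBlock, heU, heU', hfW, hfW']
  rw [this, Matrix.det_fromBlocks_zero₂₁, mul_pow]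

theorem exists_sum_equiv_of_card {i j : ℕ} (U : Finset ι) (hU : U.card = i)
    (hι : Fintype.card ι = i + j) :
    ∃ e : Fin i ⊕ Fin j ≃ ι, (∀ x, e (Sum.inl x) ∈ U) ∧ ∀ y, e (Sum.inr y) ∉ U := by
  have h2 : Fintype.card {x // x ∉ U} = j := by
    rw [Fintype.card_subtype_compl]; simp; omega
  refine ⟨(Equiv.sumCongr (Fintype.equivOfCardEq (by simp [hU]) : Fin i ≃ {x // x ∈ U})
    (Fintype.equivOfCardEq (by simp [h2]) : Fin j ≃ {x // x ∉ U})).trans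
    (Equiv.sumCompl (· ∈ U)), fun x => ?_, fun y => ?_⟩
  · simp
  · exact ((Fintype.equivOfCardEq (by simp [h2]) : Fin j ≃ {x // x ∉ U}) y).2

/-- Decoupling is applied to the columns for fixed `π` and `s`, then to the rows. The result depends
on `U` and `W` only through their common size. -/
theorem sum_perm_mixedBlock {i j : ℕ} {U W : Finset ι} (hU : U.card = i) (hW : W.card = i)
    (hι : Fintype.card ι = i + j) (hα : i + j ≤ Fintype.card α) (hβ : i + j ≤ Fintype.card β)
    (A B : Matrix α β ℝ) :
    ∑ π : Equiv.Perm α, ∑ s : ι ↪ α, ∑ π' : Equiv.Perm β, ∑ t : ι ↪ β,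
      (mixedBlock U W (A.submatrix s t) (B.submatrix (π ∘ s) (π' ∘ t))).det ^ 2
      = ((Fintype.card α).factorial * (Fintype.card α).descFactorial (i + j) : ℝ)
          / ((Fintype.card α).descFactorial i * (Fintype.card α).descFactorial j)
        * (((Fintype.card β).factorial * (Fintype.card β).descFactorial (i + j) : ℝ)
          / ((Fintype.card β).descFactorial i * (Fintype.card β).descFactorial j))
        * (sqMinorSum (Fin i) A * sqMinorSum (Fin j) B) := by
  obtain ⟨e, he, he'⟩ := exists_sum_equiv_of_card U hU hι
  obtain ⟨f, hf, hf'⟩ := exists_sum_equiv_of_card W hW hι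
  have hr := fun (s : ι ↪ α) (π : Equiv.Perm α) => sum_perm_sum_embedding (α := β)
    (Function.Embedding.inl.trans f.toEmbedding) (Function.Embedding.inr.trans f.toEmbedding)
    (hι.trans_le hβ)
    (fun u v => (A.submatrix (s ∘ e ∘ Sum.inl) u).det ^ 2
      * (B.submatrix (π ∘ s ∘ e ∘ Sum.inr) v).det ^ 2)
  have hl := sum_perm_sum_embedding (α := α)
    (Function.Embedding.inl.trans e.toEmbedding) (Function.Embedding.inr.trans e.toEmbedding)
    (hι.trans_le hα)
    (fun u v => ∑ u' : Fin i ↪ β, ∑ v' : Fin j ↪ β, (A.submatrix u u').det ^ 2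
      * (B.submatrix v v').det ^ 2)
  simp only [Fintype.card_fin, hι] at hr hl
  generalize ((Fintype.card α).factorial * (Fintype.card α).descFactorial (i + j) : ℝ)
    / ((Fintype.card α).descFactorial i * (Fintype.card α).descFactorial j) = ca at hl ⊢
  generalize ((Fintype.card β).factorial * (Fintype.card β).descFactorial (i + j) : ℝ)
    / ((Fintype.card β).descFactorial i * (Fintype.card β).descFactorial j) = cb at hr ⊢
  have h1 : ∀ (π : Equiv.Perm α) (s : ι ↪ α), ∑ π' : Equiv.Perm β, ∑ t : ι ↪ β,
      (mixedBlock U W (A.submatrix s t) (B.submatrix (π ∘ s) (π' ∘ t))).det ^ 2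
      = cb * ∑ u : Fin i ↪ β, ∑ v : Fin j ↪ β, (A.submatrix (s ∘ e ∘ Sum.inl) u).det ^ 2
          * (B.submatrix (π ∘ s ∘ e ∘ Sum.inr) v).det ^ 2 := by
    intro π s
    refine Eq.trans ?_ (hr s π)
    refine Finset.sum_congr rfl fun π' _ => Finset.sum_congr rfl fun t _ => ?_
    rw [det_mixedBlock_sq e f he he' hf hf', Matrix.submatrix_submatrix,
      Matrix.submatrix_submatrix]
    rfl
  rw [Finset.sum_congr rfl fun π _ => Finset.sum_congr rfl fun s _ => h1 π s]
  have h2 : ∑ u : Fin i ↪ α, ∑ v : Fin j ↪ α, ∑ u' : Fin i ↪ β, ∑ v' : Fin j ↪ β,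
      (A.submatrix u u').det ^ 2 * (B.submatrix v v').det ^ 2
      = sqMinorSum (Fin i) A * sqMinorSum (Fin j) B := by
    unfold sqMinorSum
    rw [Finset.sum_mul_sum]
    refine Finset.sum_congr rfl fun u _ => Finset.sum_congr rfl fun v _ => ?_
    rw [Finset.sum_mul_sum]
  rw [h2] at hl
  simp only [← Finset.mul_sum _ _ cb]
  rw [mul_comm ca, mul_assoc, ← hl]
  exact congrArg (cb * ·) (Finset.sum_congr rfl fun π _ => Finset.sum_congr rfl fun s _ =>
    Finset.sum_congr rfl fun u _ => Finset.sum_congr rfl fun v _ => rfl)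

theorem sum_comm_four {τ₁ τ₂ τ₃ τ₄ υ : Type*} [Fintype τ₁] [Fintype τ₂] [Fintype τ₃] [Fintype τ₄]
    [Fintype υ] (f : υ → τ₁ → τ₂ → τ₃ → τ₄ → ℝ) :
    ∑ u, ∑ a, ∑ b, ∑ c, ∑ x, f u a b c x = ∑ a, ∑ b, ∑ c, ∑ x, ∑ u, f u a b c x := by
  rw [Finset.sum_comm]
  refine Finset.sum_congr rfl fun a _ => ?_
  rw [Finset.sum_comm]
  refine Finset.sum_congr rfl fun b _ => ?_
  rw [Finset.sum_comm]
  exact Finset.sum_congr rfl fun c _ => Finset.sum_comm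

/-- The sum of `sqMinorSum` of `A + P B P'ᵀ` over all signed permutation matrices `P`, `P'`. -/
theorem sum_signedPerm_sqMinorSum {k : ℕ} (hα : k ≤ Fintype.card α) (hβ : k ≤ Fintype.card β)
    (A B : Matrix α β ℝ) :
    ∑ π : Equiv.Perm α, ∑ π' : Equiv.Perm β, ∑ ε : α → ℤˣ, ∑ δ : β → ℤˣ,
      sqMinorSum (Fin k) (Matrix.of fun a b =>
        A a b + ((ε a : ℤ) : ℝ) * (B (π a) (π' b) * ((δ b : ℤ) : ℝ)))
      = (2 : ℝ) ^ Fintype.card α * 2 ^ Fintype.card β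
        * ((Fintype.card α).factorial * (Fintype.card β).factorial)
        * ∑ ij ∈ Finset.HasAntidiagonal.antidiagonal k,
          (k.choose ij.1 : ℝ) ^ 2
          * (((Fintype.card α).descFactorial k : ℝ)
            / ((Fintype.card α).descFactorial ij.1 * (Fintype.card α).descFactorial ij.2))
          * (((Fintype.card β).descFactorial k : ℝ)
            / ((Fintype.card β).descFactorial ij.1 * (Fintype.card β).descFactorial ij.2))
          * (sqMinorSum (Fin ij.1) A * sqMinorSum (Fin ij.2) B) := by
  set F : ℕ → ℝ := fun i =>
    (((Fintype.card α).factorial * (Fintype.card α).descFactorial k : ℝ)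
          / ((Fintype.card α).descFactorial i * (Fintype.card α).descFactorial (k - i)))
        * (((Fintype.card β).factorial * (Fintype.card β).descFactorial k : ℝ)
          / ((Fintype.card β).descFactorial i * (Fintype.card β).descFactorial (k - i)))
        * (sqMinorSum (Fin i) A * sqMinorSum (Fin (k - i)) B) with hF
  have hUW : ∀ U W : Finset (Fin k), ∑ π : Equiv.Perm α, ∑ s : Fin k ↪ α,
      ∑ π' : Equiv.Perm β, ∑ t : Fin k ↪ β,
      (mixedBlock U W (A.submatrix s t) (B.submatrix (π ∘ s) (π' ∘ t))).det ^ 2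
      = if U.card = W.card then F U.card else 0 := by
    intro U W
    split_ifs with h
    · have hU : U.card ≤ k := by simpa using Finset.card_le_univ U
      have hk : U.card + (k - U.card) = k := by omega
      rw [sum_perm_mixedBlock (j := k - U.card) rfl h.symm (by simp [hk]) (hk.trans_le hα)
        (hk.trans_le hβ), hF, hk]
    · simp [det_mixedBlock_of_card_ne h]
  have h1 : ∀ (π : Equiv.Perm α) (π' : Equiv.Perm β), ∑ ε : α → ℤˣ, ∑ δ : β → ℤˣ,
      sqMinorSum (Fin k) (Matrix.of fun a b =>
        A a b + ((ε a : ℤ) : ℝ) * (B (π a) (π' b) * ((δ b : ℤ) : ℝ)))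
      = ∑ s : Fin k ↪ α, ∑ t : Fin k ↪ β, (2 : ℝ) ^ Fintype.card α * 2 ^ Fintype.card β
        * ∑ U : Finset (Fin k), ∑ W : Finset (Fin k),
        (mixedBlock U W (A.submatrix s t) (B.submatrix (π ∘ s) (π' ∘ t))).det ^ 2 := by
    intro π π'
    unfold sqMinorSum
    rw [Finset.sum_congr rfl fun ε _ => Finset.sum_comm, Finset.sum_comm]
    refine Finset.sum_congr rfl fun s _ => ?_
    rw [Finset.sum_congr rfl fun ε _ => Finset.sum_comm, Finset.sum_comm]
    refine Finset.sum_congr rfl fun t _ => ?_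
    rw [← sum_sign_sum_sign_det_sq]
    rfl
  simp_rw [h1, ← Finset.mul_sum]
  rw [mul_assoc (_ * _) (_ * _)]
  congr 1
  have h2 : ∑ π : Equiv.Perm α, ∑ π' : Equiv.Perm β, ∑ s : Fin k ↪ α, ∑ t : Fin k ↪ β,
      ∑ U : Finset (Fin k), ∑ W : Finset (Fin k),
        (mixedBlock U W (A.submatrix s t) (B.submatrix (π ∘ s) (π' ∘ t))).det ^ 2
      = ∑ U : Finset (Fin k), ∑ W : Finset (Fin k), if U.card = W.card then F U.card else 0 := by
    simp_rw [← hUW]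
    symm
    rw [Finset.sum_congr rfl fun U _ => sum_comm_four _, sum_comm_four]
    exact Finset.sum_congr rfl fun π _ => Finset.sum_comm
  rw [h2]
  -- There are `k.choose i` sets `W` of the same size `i` as `U`, and as many sets `U` of that size:
  -- hence the squared binomial.
  have h3 : ∀ U : Finset (Fin k), ∑ W : Finset (Fin k), (if U.card = W.card then F U.card else 0)
      = (k.choose U.card : ℝ) * F U.card := by
    intro U
    rw [← Finset.sum_filter, Finset.sum_const, nsmul_eq_mul]
    congr 2
    have : Finset.univ.filter (fun W : Finset (Fin k) => U.card = W.card)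
        = Finset.univ.powersetCard U.card := by
      ext W; simp [Finset.mem_powersetCard, eq_comm]
    rw [this]
    simp
  rw [Finset.sum_congr rfl fun U _ => h3 U, ← Finset.powerset_univ,
    Finset.sum_powerset_apply_card (fun i => (k.choose i : ℝ) * F i),
    Finset.Nat.sum_antidiagonal_eq_sum_range_succ_mk, Finset.mul_sum]
  simp only [Finset.card_univ, Fintype.card_fin]
  refine Finset.sum_congr rfl fun i _ => ?_
  simp only [hF, nsmul_eq_mul]
  ring

end MinorAverage

/-! ### The Haar average and the bilinear formula. -/

instance haarO_isProbabilityMeasure (n : ℕ) : IsProbabilityMeasure (haarO n) :=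
  ⟨by
    have := Measure.haarMeasure_self (K₀ := (⊤ : TopologicalSpace.PositiveCompacts
      (Matrix.orthogonalGroup (Fin n) ℝ)))
    simpa [haarO] using this⟩

instance haarO_isMulLeftInvariant (n : ℕ) : (haarO n).IsMulLeftInvariant := by
  unfold haarO; infer_instance

/-- If the average of `F` over finitely many pairs of left translations is constant, then so is
its Haar average. -/
theorem integral_haarO_eq_of_sum_translates {m d : ℕ} {G H : Type*} [Fintype G] [Fintype H]
    (F : Matrix.orthogonalGroup (Fin m) ℝ → Matrix.orthogonalGroup (Fin d) ℝ → ℝ)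
    (hF : Continuous (Function.uncurry F)) (u : G → Matrix.orthogonalGroup (Fin m) ℝ)
    (v : H → Matrix.orthogonalGroup (Fin d) ℝ) (c : ℝ)
    (hc : ∀ Q R, ∑ g, ∑ h, F (u g * Q) (v h * R) = c) :
    (Fintype.card G * Fintype.card H : ℝ) * ∫ Q, ∫ R, F Q R ∂(haarO d) ∂(haarO m) = c := by
  have hcont : ∀ g h, Continuous (Function.uncurry fun Q R => F (u g * Q) (v h * R)) :=
    fun g h => hF.comp (f := fun p : Matrix.orthogonalGroup (Fin m) ℝ ×
      Matrix.orthogonalGroup (Fin d) ℝ => (u g * p.1, v h * p.2)) (by fun_prop)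
  have hint : ∀ g h Q, Integrable (fun R => F (u g * Q) (v h * R)) (haarO d) := fun g h Q =>
    Continuous.integrable_of_hasCompactSupport
      ((hcont g h).comp (Continuous.prodMk_right Q)) (HasCompactSupport.of_compactSpace _)
  have hint' : ∀ g h, Integrable (fun Q => ∫ R, F (u g * Q) (v h * R) ∂(haarO d)) (haarO m) := by
    intro g h
    refine Continuous.integrable_of_hasCompactSupport ?_ (HasCompactSupport.of_compactSpace _)
    have : FirstCountableTopology (Matrix (Fin m) (Fin m) ℝ) :=
      inferInstanceAs (FirstCountableTopology (Fin m → Fin m → ℝ))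
    have : FirstCountableTopology (Matrix.orthogonalGroup (Fin m) ℝ) :=
      TopologicalSpace.Subtype.firstCountableTopology _
    have := continuous_parametric_integral_of_continuous (μ := haarO d) (hcont g h)
      (isCompact_univ)
    simpa using this
  -- Left invariance of both Haar measures: every translate has the same double integral.
  have htrans : ∀ g h, ∫ Q, ∫ R, F (u g * Q) (v h * R) ∂(haarO d) ∂(haarO m)
      = ∫ Q, ∫ R, F Q R ∂(haarO d) ∂(haarO m) := by
    intro g h
    rw [← integral_mul_left_eq_self (fun Q => ∫ R, F Q R ∂(haarO d)) (u g)]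
    refine integral_congr_ae (Eventually.of_forall fun Q => ?_)
    exact integral_mul_left_eq_self (fun R => F (u g * Q) R) (v h)
  calc (Fintype.card G * Fintype.card H : ℝ) * ∫ Q, ∫ R, F Q R ∂(haarO d) ∂(haarO m)
      = ∑ g, ∑ h, ∫ Q, ∫ R, F (u g * Q) (v h * R) ∂(haarO d) ∂(haarO m) := by
        simp [htrans, mul_assoc]
    _ = ∫ Q, ∫ R, ∑ g, ∑ h, F (u g * Q) (v h * R) ∂(haarO d) ∂(haarO m) := by
        rw [← Finset.sum_congr rfl fun g _ =>
          integral_finsetSum Finset.univ fun h _ => hint' g h]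
        rw [← integral_finsetSum Finset.univ fun g _ =>
          integrable_finsetSum Finset.univ fun h _ => hint' g h]
        refine integral_congr_ae (Eventually.of_forall fun Q => ?_)
        simp only
        rw [integral_finsetSum Finset.univ fun g _ =>
          integrable_finsetSum Finset.univ fun h _ => hint g h Q]
        refine Finset.sum_congr rfl fun g _ => ?_
        rw [integral_finsetSum Finset.univ fun h _ => hint g h Q]
    _ = c := by simp [hc]

/-- The signed permutation matrix with entry `ε a` in position `(a, π a)`. -/
def signedPerm {n : ℕ} (ε : Fin n → ℤˣ) (π : Equiv.Perm (Fin n)) :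
    Matrix.orthogonalGroup (Fin n) ℝ :=
  ⟨Matrix.of fun a b => if π a = b then ((ε a : ℤ) : ℝ) else 0, by
    rw [Matrix.mem_orthogonalGroup_iff]
    ext a b
    rcases Int.units_eq_one_or (ε a) with h | h <;>
    rcases Int.units_eq_one_or (ε b) with h' | h' <;>
    by_cases hab : a = b <;>
    simp_all [Matrix.mul_apply, Matrix.one_apply, eq_comm]⟩

theorem signedPerm_mul_apply {n : ℕ} {β : Type*} (ε : Fin n → ℤˣ) (π : Equiv.Perm (Fin n))
    (B : Matrix (Fin n) β ℝ) (a : Fin n) (b : β) :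
    ((signedPerm ε π : Matrix (Fin n) (Fin n) ℝ) * B) a b = ((ε a : ℤ) : ℝ) * B (π a) b := by
  simp [Matrix.mul_apply, signedPerm]

theorem mul_signedPerm_transpose_apply {n : ℕ} {α : Type*} (δ : Fin n → ℤˣ)
    (π : Equiv.Perm (Fin n)) (B : Matrix α (Fin n) ℝ) (a : α) (b : Fin n) :
    (B * (signedPerm δ π : Matrix (Fin n) (Fin n) ℝ).transpose) a b
      = B a (π b) * ((δ b : ℤ) : ℝ) := by
  simp [Matrix.mul_apply, signedPerm]

theorem continuous_sqMinorSum {ι α β : Type*} [Fintype ι] [DecidableEq ι] [Fintype α]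
    [DecidableEq α] [Fintype β] [DecidableEq β] :
    Continuous (sqMinorSum ι : Matrix α β ℝ → ℝ) := by
  unfold sqMinorSum
  refine continuous_finsetSum _ fun s _ => continuous_finsetSum _ fun t _ => ?_
  exact ((continuous_id.matrix_submatrix s t).matrix_det).pow 2

theorem charpoly_orthogonal_mul_mul {m d : ℕ} (Q : Matrix.orthogonalGroup (Fin m) ℝ)
    (R : Matrix.orthogonalGroup (Fin d) ℝ) (B : Matrix (Fin m) (Fin d) ℝ) :
    (((Q : Matrix (Fin m) (Fin m) ℝ) * B * (R : Matrix (Fin d) (Fin d) ℝ).transpose).transpose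
      * ((Q : Matrix (Fin m) (Fin m) ℝ) * B
        * (R : Matrix (Fin d) (Fin d) ℝ).transpose)).charpoly = (B.transpose * B).charpoly := by
  have hQ : (Q : Matrix (Fin m) (Fin m) ℝ).transpose * (Q : Matrix (Fin m) (Fin m) ℝ) = 1 :=
    (Matrix.mem_orthogonalGroup_iff' _ _).mp Q.2
  have hR : (R : Matrix (Fin d) (Fin d) ℝ).transpose * (R : Matrix (Fin d) (Fin d) ℝ) = 1 :=
    (Matrix.mem_orthogonalGroup_iff' _ _).mp R.2
  simp only [Matrix.transpose_mul, Matrix.transpose_transpose]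
  have h : (R : Matrix (Fin d) (Fin d) ℝ) * (B.transpose * (Q : Matrix (Fin m) (Fin m) ℝ).transpose)
      * ((Q : Matrix (Fin m) (Fin m) ℝ) * B * (R : Matrix (Fin d) (Fin d) ℝ).transpose)
      = (R : Matrix (Fin d) (Fin d) ℝ)
        * (B.transpose * B * (R : Matrix (Fin d) (Fin d) ℝ).transpose) := by
    simp only [Matrix.mul_assoc]
    rw [← Matrix.mul_assoc _ (Q : Matrix (Fin m) (Fin m) ℝ), hQ, Matrix.one_mul]
  rw [h, Matrix.charpoly_mul_comm, Matrix.mul_assoc, hR, Matrix.mul_one]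

/-- A sum of squared minors is, up to a nonzero constant, a coefficient of a characteristic
polynomial that `Q` and `R` only conjugate. -/
theorem sqMinorSum_orthogonal_mul_mul {m d k : ℕ} (hk : k ≤ d)
    (Q : Matrix.orthogonalGroup (Fin m) ℝ)
    (R : Matrix.orthogonalGroup (Fin d) ℝ) (B : Matrix (Fin m) (Fin d) ℝ) :
    sqMinorSum (Fin k) ((Q : Matrix (Fin m) (Fin m) ℝ) * B
      * (R : Matrix (Fin d) (Fin d) ℝ).transpose) = sqMinorSum (Fin k) B := by
  have h1 := charpoly_transpose_mul_self_coeff ((Q : Matrix (Fin m) (Fin m) ℝ) * B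
      * (R : Matrix (Fin d) (Fin d) ℝ).transpose) k (by simpa using hk)
  rw [charpoly_orthogonal_mul_mul,
    charpoly_transpose_mul_self_coeff B k (by simpa using hk)] at h1
  exact (mul_left_cancel₀ (by positivity) h1).symm

theorem integral_sqMinorSum {m d k : ℕ} (hk : k ≤ d) (hdm : d ≤ m)
    (A B : Matrix (Fin m) (Fin d) ℝ) :
    ∫ Q : Matrix.orthogonalGroup (Fin m) ℝ, ∫ R : Matrix.orthogonalGroup (Fin d) ℝ,
      sqMinorSum (Fin k) (A + (Q : Matrix (Fin m) (Fin m) ℝ) * B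
        * (R : Matrix (Fin d) (Fin d) ℝ).transpose) ∂(haarO d) ∂(haarO m)
      = ∑ ij ∈ Finset.HasAntidiagonal.antidiagonal k,
          (k.choose ij.1 : ℝ) ^ 2
          * ((m.descFactorial k : ℝ) / (m.descFactorial ij.1 * m.descFactorial ij.2))
          * ((d.descFactorial k : ℝ) / (d.descFactorial ij.1 * d.descFactorial ij.2))
          * (sqMinorSum (Fin ij.1) A * sqMinorSum (Fin ij.2) B) := by
  have h := integral_haarO_eq_of_sum_translates
    (G := Equiv.Perm (Fin m) × (Fin m → ℤˣ)) (H := Equiv.Perm (Fin d) × (Fin d → ℤˣ))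
    (fun (Q : Matrix.orthogonalGroup (Fin m) ℝ) (R : Matrix.orthogonalGroup (Fin d) ℝ) =>
      sqMinorSum (Fin k) (A + (Q : Matrix (Fin m) (Fin m) ℝ) * B
        * (R : Matrix (Fin d) (Fin d) ℝ).transpose))
    (continuous_sqMinorSum.comp (continuous_const.add
      (((continuous_subtype_val.comp continuous_fst).matrix_mul continuous_const).matrix_mul
        (continuous_subtype_val.comp continuous_snd).matrix_transpose)))
    (fun g => signedPerm g.2 g.1) (fun g => signedPerm g.2 g.1) _ (fun Q R => by
      have h1 := sum_signedPerm_sqMinorSum (k := k) (by simpa using hk.trans hdm)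
        (by simpa using hk) A ((Q : Matrix (Fin m) (Fin m) ℝ) * B
        * (R : Matrix (Fin d) (Fin d) ℝ).transpose)
      have h2 : ∀ ij ∈ Finset.HasAntidiagonal.antidiagonal k,
          sqMinorSum (Fin ij.2) ((Q : Matrix (Fin m) (Fin m) ℝ) * B
            * (R : Matrix (Fin d) (Fin d) ℝ).transpose) = sqMinorSum (Fin ij.2) B :=
        fun ij hij => sqMinorSum_orthogonal_mul_mul
          (le_of_add_le_right ((Finset.HasAntidiagonal.mem_antidiagonal.mp hij).trans_le hk)) Q R B
      rw [Finset.sum_congr (s₁ := Finset.HasAntidiagonal.antidiagonal k) rfl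
        fun ij hij => congrArg _ (congrArg _ (h2 ij hij))] at h1
      refine Eq.trans ?_ h1
      rw [Fintype.sum_prod_type]
      refine Finset.sum_congr rfl fun π _ => ?_
      rw [Finset.sum_congr rfl fun ε _ => Fintype.sum_prod_type _, Finset.sum_comm]
      refine Finset.sum_congr rfl fun π' _ => Finset.sum_congr rfl fun ε _ =>
        Finset.sum_congr rfl fun δ _ => ?_
      congr 1
      ext a b
      rw [Matrix.add_apply, Matrix.of_apply]
      congr 1
      rw [Submonoid.coe_mul, Submonoid.coe_mul, Matrix.transpose_mul, Matrix.mul_assoc,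
        Matrix.mul_assoc, signedPerm_mul_apply, ← Matrix.mul_assoc, ← Matrix.mul_assoc,
        mul_signedPerm_transpose_apply])
  have hcard : (Fintype.card (Equiv.Perm (Fin m) × (Fin m → ℤˣ))
      * Fintype.card (Equiv.Perm (Fin d) × (Fin d → ℤˣ)) : ℝ)
      = 2 ^ m * 2 ^ d * (m.factorial * d.factorial) := by
    simp [Fintype.card_perm]
    ring
  rw [hcard] at h
  simp only [Fintype.card_fin] at h
  exact mul_left_cancel₀ (by positivity) h

theorem avgCharpoly_eq_rectConvExt {m d : ℕ} (hdm : d ≤ m) (A B : Matrix (Fin m) (Fin d) ℝ) :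
    avgCharpoly A B
      = rectConvExt m d (A.transpose * A).charpoly (B.transpose * B).charpoly := by
  unfold avgCharpoly rectConvExt
  -- One side is indexed by the exponent of `x`, the other by `d` minus the exponent.
  rw [← Finset.sum_range_reflect]
  refine Finset.sum_congr rfl fun k hk => ?_
  have hk' : k ≤ d := Nat.lt_succ_iff.mp (Finset.mem_range.mp hk)
  rw [show d + 1 - 1 - k = d - k by omega]
  congr 1
  have hco : ∀ (M : Matrix (Fin m) (Fin d) ℝ) (i : ℕ), i ≤ d →
      (M.transpose * M).charpoly.coeff (d - i)
        = (-1) ^ i / (i.factorial : ℝ) ^ 2 * sqMinorSum (Fin i) M := by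
    intro M i hi
    have := charpoly_transpose_mul_self_coeff M i (by simpa using hi)
    simpa using this
  simp only [hco _ k hk', integral_const_mul]
  rw [integral_sqMinorSum hk' hdm, Finset.mul_sum]
  refine Finset.sum_congr rfl fun ij hij => ?_
  obtain ⟨i, j⟩ := ij
  have hij' : i + j = k := Finset.HasAntidiagonal.mem_antidiagonal.mp hij
  subst hij'
  simp only
  rw [hco A i (by omega), hco B j (by omega)]
  have hdesc : ∀ n l : ℕ, l ≤ n →
      (n.descFactorial l : ℝ) = (n.factorial : ℝ) / ((n - l).factorial : ℝ) := by
    intro n l hl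
    rw [eq_div_iff (by positivity), mul_comm]
    exact_mod_cast Nat.factorial_mul_descFactorial hl
  -- The prefactor `1/k!²` times `(k.choose i)²` is `1/(i! j!)²`, exactly the normalization of the
  -- two coefficients on the right.
  rw [hdesc m _ (by omega), hdesc m _ (by omega), hdesc m _ (by omega), hdesc d _ (by omega),
    hdesc d _ (by omega), hdesc d _ (by omega), Nat.cast_add_choose, pow_add]
  field_simp

/-- The chosen matrices enter only through their characteristic polynomials, so neither the choice
nor the case distinction matters. -/
theorem rectConv_eq_rectConvExt {m d : ℕ} (hdm : d ≤ m) (p q : ℝ[X]) :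
    rectConv m d p q = rectConvExt m d p q := by
  unfold rectConv
  split_ifs with h
  · rw [avgCharpoly_eq_rectConvExt hdm, h.choose_spec.1, h.choose_spec.2]
  · rfl

/-! ### Coefficient growth in products of power series. -/

section Asymptotics

open Asymptotics

theorem tendsto_choose_succ_atTop (k : ℕ) :
    Tendsto (fun n : ℕ => (n.choose (k + 1) : ℝ)) atTop atTop := by
  refine (isEquivalent_choose (k + 1)).symm.tendsto_atTop ?_
  refine Tendsto.atTop_div_const (by positivity) ?_
  exact (tendsto_pow_atTop (by omega)).comp tendsto_natCast_atTop_atTop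

theorem sum_range_choose_eq (n k : ℕ) : ∑ i ∈ Finset.range n, i.choose k = n.choose (k + 1) := by
  induction n with
  | zero => simp
  | succ n ih => rw [Finset.sum_range_succ, ih, Nat.choose_succ_succ, add_comm]

/-- A form of the Stolz–Cesàro theorem, with binomial coefficients as the scale. -/
theorem isLittleO_choose_succ_of_sub (x : ℕ → ℝ) (L : ℝ) (k : ℕ)
    (h : (fun n => x (n + 1) - x n - L * n.choose k) =o[atTop] fun n : ℕ => (n.choose k : ℝ)) :
    (fun n => x n - L * n.choose (k + 1)) =o[atTop] fun n : ℕ => (n.choose (k + 1) : ℝ) := by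
  have hsum : ∀ n : ℕ, ∑ i ∈ Finset.range n, (i.choose k : ℝ) = n.choose (k + 1) := by
    intro n
    exact_mod_cast sum_range_choose_eq n k
  have h1 := h.sum_range (fun n => by positivity) (by
    simp_rw [hsum]; exact tendsto_choose_succ_atTop k)
  have hx : ∀ n : ℕ, ∑ i ∈ Finset.range n, (x (i + 1) - x i - L * i.choose k)
      = x n - x 0 - L * n.choose (k + 1) := by
    intro n
    rw [Finset.sum_sub_distrib, Finset.sum_range_sub, ← Finset.mul_sum, hsum]
  simp_rw [hsum, hx] at h1
  -- Telescoping leaves the initial value `x 0`, negligible because the scale diverges.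
  have h2 : (fun _ : ℕ => x 0) =o[atTop] fun n : ℕ => (n.choose (k + 1) : ℝ) :=
    isLittleO_const_left.mpr (Or.inr
      (tendsto_norm_atTop_atTop.comp (tendsto_choose_succ_atTop k)))
  exact (h1.add h2).congr_left fun n => by ring

theorem choose_isLittleO_choose {i k : ℕ} (h : i < k) :
    (fun n : ℕ => (n.choose i : ℝ)) =o[atTop] fun n : ℕ => (n.choose k : ℝ) := by
  refine (isTheta_choose i).trans_isLittleO (IsLittleO.trans_isTheta ?_ (isTheta_choose k).symm)
  exact (isLittleO_pow_pow_atTop_of_lt h).comp_tendsto tendsto_natCast_atTop_atTop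

/-- The coefficients of a product of `N` power series `1 + a z + O(z²)` with uniformly bounded
coefficients grow like those of `(1 + a z)^N`. -/
theorem isLittleO_sub_choose_of_recurrence (d : ℕ) (c u : ℕ → ℕ → ℝ) (a K : ℝ)
    (hc : ∀ N, c N 0 = 1) (hu0 : ∀ N, u N 0 = 1) (hu1 : ∀ N, 1 ≤ d → u N 1 = a)
    (hu : ∀ N j, j ≤ d → |u N j| ≤ K)
    (hrec : ∀ N k, k ≤ d →
      c (N + 1) k = ∑ ij ∈ Finset.HasAntidiagonal.antidiagonal k, c N ij.1 * u N ij.2) :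
    ∀ k, k ≤ d → (fun N => c N k - a ^ k * N.choose k) =o[atTop]
      fun N : ℕ => (N.choose k : ℝ) := by
  intro k
  induction k using Nat.strong_induction_on with
  | _ k ih =>
    intro hk
    match k with
    | 0 => simp [hc]
    | k + 1 =>
      refine isLittleO_choose_succ_of_sub (fun N => c N (k + 1)) (a ^ (k + 1)) k ?_
      -- In the recurrence for `c (N + 1) (k + 1)`, the term `i = k + 1` is `c N (k + 1)` and
      -- cancels in the difference, the term `i = k` is `a * c N k`, and all terms with `i < k` are
      -- of lower order.
      have hsmall : ∀ i ∈ Finset.range k, (fun N => c N i * u N (k + 1 - i)) =o[atTop]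
          fun N : ℕ => (N.choose k : ℝ) := by
        intro i hi
        have hi' : i < k := Finset.mem_range.mp hi
        have h1 : (fun N => c N i) =O[atTop] fun N : ℕ => (N.choose i : ℝ) := by
          have := (ih i (by omega) (by omega)).isBigO.add
            ((isBigO_refl (fun N : ℕ => (N.choose i : ℝ)) atTop).const_mul_left (a ^ i))
          simpa using this
        have h2 : (fun N => u N (k + 1 - i)) =O[atTop] fun _ : ℕ => (1 : ℝ) :=
          IsBigO.of_bound K (Eventually.of_forall fun N => by
            simpa using hu N (k + 1 - i) (by omega))
        have h3 := h1.mul h2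
        simp only [mul_one] at h3
        exact h3.trans_isLittleO (choose_isLittleO_choose hi')
      have h4 := (IsLittleO.sum hsmall).add
        ((ih k (by omega) (by omega)).const_mul_left a)
      refine h4.congr_left fun N => ?_
      rw [hrec N (k + 1) hk, Finset.Nat.sum_antidiagonal_eq_sum_range_succ_mk,
        Finset.sum_range_succ, Finset.sum_range_succ]
      simp only [Finset.sum_apply, Nat.sub_self, hu0, show k + 1 - k = 1 by omega, hu1 N (by omega)]
      ring

theorem tendsto_div_pow_of_isLittleO_sub_choose (x : ℕ → ℝ) (L : ℝ) (k : ℕ)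
    (h : (fun N => x N - L * N.choose k) =o[atTop] fun N : ℕ => (N.choose k : ℝ)) :
    Tendsto (fun N : ℕ => x N / (N : ℝ) ^ k) atTop (nhds (L / k.factorial)) := by
  have hne : ∀ᶠ N : ℕ in atTop, (N : ℝ) ^ k ≠ 0 := by
    filter_upwards [eventually_ge_atTop 1] with N hN
    positivity
  have h1 := (h.trans_isTheta (isTheta_choose k)).tendsto_div_nhds_zero
  have h2 : Tendsto (fun N : ℕ => (N.choose k : ℝ) / (N : ℝ) ^ k) atTop
      (nhds (1 / k.factorial)) := by
    have hk : (k.factorial : ℝ) ≠ 0 := by positivity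
    have h3 := (isEquivalent_iff_tendsto_one (by
      filter_upwards [hne] with N hN
      exact div_ne_zero hN hk)).mp (isEquivalent_choose k)
    have h4 := h3.mul_const (1 / (k.factorial : ℝ))
    rw [one_mul] at h4
    refine h4.congr' ?_
    filter_upwards [hne] with N hN
    simp only [Pi.div_apply]
    field_simp
  have h5 := h1.add (h2.const_mul L)
  rw [zero_add, mul_one_div] at h5
  refine h5.congr fun N => ?_
  ring

end Asymptotics

/-! ### Convolution as a Cauchy product. -/

/-- The coefficients of `p` normalized so that the rectangular convolution becomes the Cauchy
product. -/
noncomputable def rectCoeff (m d : ℕ) (p : ℝ[X]) (k : ℕ) : ℝ :=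
  p.coeff (d - k) * ((d - k).factorial * (m - k).factorial) / (d.factorial * m.factorial)

theorem coeff_rectConvExt {m d k : ℕ} (hk : k ≤ d) (p q : ℝ[X]) :
    (rectConvExt m d p q).coeff (d - k) = ∑ ij ∈ Finset.HasAntidiagonal.antidiagonal k,
      (((d - ij.1).factorial * (d - ij.2).factorial : ℝ) / (d.factorial * (d - k).factorial))
      * (((m - ij.1).factorial * (m - ij.2).factorial : ℝ) / (m.factorial * (m - k).factorial))
      * p.coeff (d - ij.1) * q.coeff (d - ij.2) := by
  unfold rectConvExt
  rw [finsetSum_coeff, Finset.sum_eq_single k]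
  · simp
  · intro l hl hlk
    rw [coeff_monomial, if_neg]
    have := Finset.mem_range.mp hl
    omega
  · intro h
    exact absurd (Finset.mem_range.mpr (by omega)) h

theorem rectCoeff_rectConvExt {m d k : ℕ} (hk : k ≤ d) (p q : ℝ[X]) :
    rectCoeff m d (rectConvExt m d p q) k
      = ∑ ij ∈ Finset.HasAntidiagonal.antidiagonal k,
        rectCoeff m d p ij.1 * rectCoeff m d q ij.2 := by
  unfold rectCoeff
  rw [coeff_rectConvExt hk, Finset.sum_mul, Finset.sum_div]
  refine Finset.sum_congr rfl fun ij _ => ?_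
  field_simp

theorem natDegree_rectConvExt_le (m d : ℕ) (p q : ℝ[X]) :
    (rectConvExt m d p q).natDegree ≤ d := by
  unfold rectConvExt
  refine natDegree_sum_le_of_forall_le _ _ fun k _ => ?_
  exact (natDegree_monomial_le _).trans (Nat.sub_le _ _)

theorem rectCoeff_zero {m d : ℕ} (p : ℝ[X]) : rectCoeff m d p 0 = p.coeff d := by
  unfold rectCoeff
  simp only [Nat.sub_zero]
  field_simp

theorem rectCoeff_X_pow {m d k : ℕ} (hk : k ≤ d) :
    rectCoeff m d (X ^ d) k = if k = 0 then 1 else 0 := by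
  split_ifs with h
  · subst h; rw [rectCoeff_zero]; simp
  · unfold rectCoeff
    rw [coeff_X_pow, if_neg (by omega)]
    simp

/-- The one-fold convolution is `p 0` by definition; it obeys the recurrence because the normalized
coefficients of `X ^ d` are those of the series `1`. -/
theorem rectCoeff_rectConvN_succ {m d : ℕ} (hdm : d ≤ m) (p : ℕ → ℝ[X]) (N k : ℕ) (hk : k ≤ d) :
    rectCoeff m d (rectConvN m d p (N + 1)) k
      = ∑ ij ∈ Finset.HasAntidiagonal.antidiagonal k,
        rectCoeff m d (rectConvN m d p N) ij.1 * rectCoeff m d (p N) ij.2 := by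
  match N with
  | 0 =>
    rw [Finset.sum_eq_single (0, k)]
    · simp [rectConvN, rectCoeff_X_pow]
    · rintro ⟨i, j⟩ hij hne
      have h := Finset.HasAntidiagonal.mem_antidiagonal.mp hij
      simp only at h
      have hi : i ≠ 0 := by
        rintro rfl
        exact hne (by simp at h; simp [h])
      simp [rectConvN, rectCoeff_X_pow (show i ≤ d by omega), hi]
    · intro h
      exact absurd (Finset.HasAntidiagonal.mem_antidiagonal.mpr (by simp)) h
  | N + 1 =>
    rw [rectConvN, rectConv_eq_rectConvExt hdm, rectCoeff_rectConvExt hk]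

theorem natDegree_rectConvN_le {m d : ℕ} (hdm : d ≤ m) (p : ℕ → ℝ[X])
    (hp : (p 0).natDegree ≤ d) (N : ℕ) : (rectConvN m d p N).natDegree ≤ d := by
  match N with
  | 0 => simp [rectConvN]
  | 1 => simpa [rectConvN] using hp
  | N + 2 =>
    rw [rectConvN, rectConv_eq_rectConvExt hdm]
    exact natDegree_rectConvExt_le _ _ _ _

/-! ### Coefficient bounds, scaling, and the limit. -/

theorem abs_coeff_prod_X_sub_C_le {ι : Type*} (s : Finset ι) (z : ι → ℝ) {B : ℝ}
    (hz : ∀ i ∈ s, |z i| ≤ B) (k : ℕ) : |(∏ i ∈ s, (X - C (z i))).coeff k| ≤ (1 + B) ^ s.card := by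
  classical
  induction s using Finset.induction_on generalizing k with
  | empty =>
    simp only [Finset.prod_empty, Finset.card_empty, pow_zero, coeff_one]
    split_ifs <;> simp
  | insert a s ha ih =>
    have hB : 0 ≤ B := (abs_nonneg _).trans (hz a (Finset.mem_insert_self a s))
    have ih' := ih fun i hi => hz i (Finset.mem_insert_of_mem hi)
    rw [Finset.prod_insert ha, Finset.card_insert_of_notMem ha, sub_mul, coeff_sub, coeff_C_mul,
      pow_succ, mul_comm X]
    have h1 : |((∏ i ∈ s, (X - C (z i))) * X).coeff k| ≤ (1 + B) ^ s.card := by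
      cases k with
      | zero => simp; positivity
      | succ k => rw [coeff_mul_X]; exact ih' k
    have h2 : |z a * (∏ i ∈ s, (X - C (z i))).coeff k| ≤ B * (1 + B) ^ s.card := by
      rw [abs_mul]
      exact mul_le_mul (hz a (Finset.mem_insert_self a s)) (ih' k) (abs_nonneg _) hB
    calc _ ≤ _ := abs_sub _ _
      _ ≤ (1 + B) ^ s.card + B * (1 + B) ^ s.card := add_le_add h1 h2
      _ = _ := by ring

theorem coeff_symmetrization (p : ℝ[X]) (n : ℕ) :
    (symmetrization p).coeff n = if 2 ∣ n then p.coeff (n / 2) else 0 := by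
  rw [symmetrization, ← expand_eq_comp_X_pow, coeff_expand two_pos]

theorem natDegree_symmetrization (p : ℝ[X]) : (symmetrization p).natDegree = p.natDegree * 2 := by
  rw [symmetrization, natDegree_comp, natDegree_X_pow]

/-- `scaleRoots` weights a coefficient by its distance from the top degree, here `2 * k`, so the
exact degree of `p` is needed. -/
theorem coeff_rootNormalize_symmetrization {p : ℝ[X]} {d k : ℕ} (hp : p.natDegree = d)
    (hk : k ≤ d) (N : ℕ) :
    (rootNormalize (1 / Real.sqrt N) (symmetrization p)).coeff (2 * (d - k))
      = p.coeff (d - k) / (N : ℝ) ^ k := by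
  rw [rootNormalize, coeff_scaleRoots, coeff_symmetrization, if_pos (dvd_mul_right _ _),
    natDegree_symmetrization, hp, show d * 2 - 2 * (d - k) = 2 * k by omega, pow_mul, div_pow,
    Real.sq_sqrt (Nat.cast_nonneg N), Nat.mul_div_cancel_left _ two_pos]
  simp [div_eq_mul_inv]

theorem coeff_genLaguerre_comp (n a : ℕ) (b : ℝ) (l : ℕ) :
    ((genLaguerre n a).comp (C b * X ^ 2)).coeff l = if 2 ∣ l then
      (genLaguerre n a).coeff (l / 2) * b ^ (l / 2) else 0 := by
  have h : (genLaguerre n a).comp (C b * X ^ 2)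
      = symmetrization ((genLaguerre n a).comp (C b * X)) := by
    simp [symmetrization, comp_assoc]
  rw [h, coeff_symmetrization]
  simp [comp_C_mul_X_coeff]

theorem coeff_genLaguerre (n a l : ℕ) : (genLaguerre n a).coeff l
    = if l ≤ n then (-1 : ℝ) ^ l * ((n + a).choose (n - l) : ℝ) / (l.factorial : ℝ) else 0 := by
  unfold genLaguerre
  simp [finsetSum_coeff, coeff_monomial]

/-- The uniform degree bound passes to the limit, so evaluation is a finite sum of fixed length. -/
theorem tendsto_eval_of_tendsto_coeff {f : ℕ → ℝ[X]} {P : ℝ[X]} {D : ℕ}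
    (hf : ∀ N, (f N).natDegree ≤ D)
    (h : ∀ k, Tendsto (fun N => (f N).coeff k) atTop (nhds (P.coeff k))) (x : ℝ) :
    Tendsto (fun N => (f N).eval x) atTop (nhds (P.eval x)) := by
  have hP : P.natDegree ≤ D := by
    rw [natDegree_le_iff_coeff_eq_zero]
    intro k hk
    refine tendsto_nhds_unique (h k) (tendsto_const_nhds.congr fun N => ?_)
    exact (coeff_eq_zero_of_natDegree_lt ((hf N).trans_lt hk)).symm
  have h1 : ∀ N, (f N).eval x = ∑ i ∈ Finset.range (D + 1), (f N).coeff i * x ^ i :=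
    fun N => eval_eq_sum_range' (Nat.lt_succ_of_le (hf N)) x
  simp_rw [h1]
  rw [eval_eq_sum_range' (Nat.lt_succ_of_le hP) x]
  exact tendsto_finsetSum _ fun i _ => (h i).mul_const _

theorem tendsto_coeff_rectConvN (m d : ℕ) (hd : 1 ≤ d) (hdm : d ≤ m) (σ : ℝ)
    (r : ℕ → Fin d → ℝ) (p : ℕ → ℝ[X])
    (hp : ∀ i, p i = ∏ j, (X - C (r i j ^ 2)))
    (hmean : ∀ i, (1 / (d : ℝ)) * ∑ j, r i j ^ 2 = σ ^ 2) :
    (∀ N, (rectConvN m d p N).natDegree = d) ∧ ∀ k ≤ d,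
      Tendsto (fun N : ℕ => (rectConvN m d p N).coeff (d - k) / (N : ℝ) ^ k) atTop
        (nhds ((-σ ^ 2 / m) ^ k / k.factorial
          * ((d.factorial * m.factorial) / ((d - k).factorial * (m - k).factorial)))) := by
  have hd0 : (0 : ℝ) < d := by exact_mod_cast hd
  have hsum : ∀ i, ∑ j, r i j ^ 2 = d * σ ^ 2 := by
    intro i
    rw [← hmean i]
    field_simp
  have hdeg : ∀ i, (p i).natDegree = d := by
    intro i
    rw [hp, natDegree_prod_of_monic _ _ fun j _ => monic_X_sub_C _]
    simp only [natDegree_X_sub_C]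
    simp
  have hmonic : ∀ i, (p i).Monic := fun i => by
    rw [hp]; exact monic_prod_of_monic _ _ fun j _ => monic_X_sub_C _
  have hu0 : ∀ N, rectCoeff m d (p N) 0 = 1 := by
    intro N
    rw [rectCoeff_zero]
    have := hmonic N
    rwa [Monic, leadingCoeff, hdeg] at this
  have hrec := fun N k => rectCoeff_rectConvN_succ hdm p N k
  have hc0 : ∀ N, rectCoeff m d (rectConvN m d p N) 0 = 1 := by
    intro N
    induction N with
    | zero => simp [rectConvN, rectCoeff_X_pow]
    | succ N ih => rw [hrec N 0 (Nat.zero_le d)]; simp [ih, hu0]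
  have hu1 : ∀ N, 1 ≤ d → rectCoeff m d (p N) 1 = -σ ^ 2 / m := by
    intro N _
    have h1 : (p N).coeff (d - 1) = -(d * σ ^ 2) := by
      have := prod_X_sub_C_coeff_card_pred Finset.univ (fun j : Fin d => r N j ^ 2)
        (by rw [Finset.card_univ, Fintype.card_fin]; exact hd)
      rw [hp, ← hsum N]
      simpa using this
    unfold rectCoeff
    rw [h1]
    obtain ⟨d, rfl⟩ : ∃ d', d = d' + 1 := ⟨d - 1, by omega⟩
    obtain ⟨m, rfl⟩ : ∃ m', m = m' + 1 := ⟨m - 1, by omega⟩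
    simp only [Nat.add_sub_cancel, Nat.factorial_succ]
    push_cast
    field_simp
  -- A nonnegative root is at most the sum `d * σ ^ 2` of all roots, and the factorial weight in
  -- `rectCoeff` is at most `1`.
  have hu : ∀ N j, j ≤ d → |rectCoeff m d (p N) j| ≤ (1 + d * σ ^ 2) ^ d := by
    intro N j hj
    have h1 := abs_coeff_prod_X_sub_C_le Finset.univ (fun j : Fin d => r N j ^ 2)
      (B := d * σ ^ 2) (fun j _ => by
        rw [abs_of_nonneg (sq_nonneg _), ← hsum N]
        exact Finset.single_le_sum (f := fun j => r N j ^ 2) (fun _ _ => sq_nonneg _)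
          (Finset.mem_univ j)) (d - j)
    rw [← hp, Finset.card_univ, Fintype.card_fin] at h1
    unfold rectCoeff
    rw [mul_div_assoc, abs_mul]
    refine (mul_le_of_le_one_right (abs_nonneg _) ?_).trans h1
    rw [abs_of_nonneg (by positivity), div_le_one (by positivity)]
    gcongr <;> omega
  have hasymp := isLittleO_sub_choose_of_recurrence d
    (fun N => rectCoeff m d (rectConvN m d p N)) (fun N => rectCoeff m d (p N)) (-σ ^ 2 / m)
    ((1 + d * σ ^ 2) ^ d) hc0 hu0 hu1 hu hrec
  refine ⟨fun N => le_antisymm (natDegree_rectConvN_le hdm p (hdeg 0).le N) ?_, fun k hk => ?_⟩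
  · refine le_natDegree_of_ne_zero ?_
    rw [← rectCoeff_zero (m := m), hc0]
    exact one_ne_zero
  · have h1 := tendsto_div_pow_of_isLittleO_sub_choose _ _ k (hasymp k hk)
    refine (h1.mul_const _).congr fun N => ?_
    unfold rectCoeff
    field_simp

theorem mainTheorem5 (m d : ℕ) (hd : 1 ≤ d) (hdm : d ≤ m) (σ : ℝ) (hσ : 0 < σ)
    (r : ℕ → Fin d → ℝ) (p : ℕ → ℝ[X])
    (hp : ∀ i, p i = ∏ j, (X - C (r i j ^ 2)))
    (hmean : ∀ i, (1 / (d : ℝ)) * ∑ j, r i j ^ 2 = σ ^ 2) :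
    ∃ P : ℝ[X],
      ScalarEquiv P ((genLaguerre d (m - d)).comp (C ((m : ℝ) / σ ^ 2) * X ^ 2)) ∧
      (∀ k : ℕ, Tendsto
        (fun N : ℕ => (rootNormalize (1 / Real.sqrt N)
          (symmetrization (rectConvN m d p N))).coeff k)
        atTop (nhds (P.coeff k))) ∧
      (∀ x : ℝ, Tendsto
        (fun N : ℕ => (rootNormalize (1 / Real.sqrt N)
          (symmetrization (rectConvN m d p N))).eval x)
        atTop (nhds (P.eval x))) := by
  obtain ⟨hdeg, hlim⟩ := tendsto_coeff_rectConvN m d hd hdm σ r p hp hmean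
  have hm0 : (m : ℝ) ≠ 0 := by
    have : 1 ≤ m := hd.trans hdm
    positivity
  have hdegN : ∀ N : ℕ, (rootNormalize (1 / Real.sqrt N)
      (symmetrization (rectConvN m d p N))).natDegree ≤ d * 2 := by
    intro N
    rw [rootNormalize, natDegree_scaleRoots, natDegree_symmetrization, hdeg]
  have hcoeff : ∀ l : ℕ, Tendsto (fun N : ℕ => (rootNormalize (1 / Real.sqrt N)
      (symmetrization (rectConvN m d p N))).coeff l) atTop
      -- This constant is the inverse of the leading coefficient of the Laguerre polynomial in `m
      -- x²/σ²`, which makes the limit monic.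
      (nhds ((C ((-1) ^ d * d.factorial * (σ ^ 2 / m) ^ d)
        * (genLaguerre d (m - d)).comp (C ((m : ℝ) / σ ^ 2) * X ^ 2)).coeff l)) := by
    intro l
    rw [coeff_C_mul, coeff_genLaguerre_comp, coeff_genLaguerre]
    split_ifs with h2 hl
    · obtain ⟨q, rfl⟩ := h2
      rw [Nat.mul_div_cancel_left _ two_pos] at hl ⊢
      obtain ⟨k, hk, rfl⟩ : ∃ k, k ≤ d ∧ q = d - k := ⟨d - q, by omega, by omega⟩
      simp_rw [coeff_rootNormalize_symmetrization (hdeg _) hk]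
      convert hlim k hk using 2
      rw [show d + (m - d) = m by omega, show d - (d - k) = k by omega,
        Nat.cast_choose ℝ (hk.trans hdm)]
      obtain ⟨e, rfl⟩ : ∃ e, d = e + k := ⟨d - k, by omega⟩
      -- With `d = e + k`, the signs `(-1)^d` of the constant and `(-1)^e` of the Laguerre
      -- coefficient must combine to `(-1)^k`.
      have hs : ((-1 : ℝ) ^ e) * (-1) ^ e = 1 := by rw [← mul_pow]; simp
      simp only [Nat.add_sub_cancel, pow_add, div_pow, neg_pow (σ ^ 2)]
      field_simp
      linear_combination hs
    · refine tendsto_const_nhds.congr fun N => ?_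
      rw [zero_mul, mul_zero, coeff_eq_zero_of_natDegree_lt]
      refine (hdegN N).trans_lt ?_
      omega
    · refine tendsto_const_nhds.congr fun N => ?_
      rw [rootNormalize, coeff_scaleRoots, coeff_symmetrization, if_neg h2, mul_zero, zero_mul]
  exact ⟨_, ⟨_, by positivity, rfl⟩, hcoeff, tendsto_eval_of_tendsto_coeff hdegN hcoeff⟩
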